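/- There exist absolute constants $\widetilde\beta_c\in(0,1)$ and $\widetilde C>0$ such that the following holds. Let $n_1,n_2,n_3\ge 2$, $r\le\min\{n_1,n_2\}$, $n_2n_3<s\le rn_2n_3$ and $1\le m\le n_1n_2n_3$ be integers, and let $0<\zeta<b$ be real numbers. For $\mathcal A\in\mathbb R^{n_1\times r\times n_3}$ and $\mathcal B\in\mathbb R^{r\times n_2\times n_3}$ let $\mathcal A\diamond\mathcal B\in\mathbb R^{n_1\times n_2\times n_3}$ be the tensor-tensor product, $(\mathcal A\diamond\mathcal B)_{ijk}=\sum_{l=1}^{r}\sum_{p+q\equiv k+1\ (\mathrm{mod}\ n_3)}\mathcal A_{ilp}\,\mathcal B_{ljq}$ (where $1\le p,q\le n_3$), let $\|\mathcal B\|_0$ be the number of nonzero entries of $\mathcal B$, let $\|\cdot\|_F$ be the Frobenius norm, and let $$\widetilde{\mathfrak U}(r,b,s,\zeta)=\big\{\mathcal X=\mathcal A\diamond\mathcal B\in\mathbb R_+^{n_1\times n_2\times n_3}:\ \mathcal X_{ijk}\ge\zeta,\ 0\le\mathcal A_{ijk}\le 1,\ 0\le\mathcal B_{ijk}\le b,\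 \|\mathcal B\|_0\le s\big\}.$$ Let $\Omega$ be a random set that contains each index $(i,j,k)$, $1\le i\le n_1$, $1\le j\le n_2$, $1\le k\le n_3$, independently with probability $\gamma=\frac{m}{n_1n_2n_3}$. Given $\Omega$, let the observations $\mathcal Y_{ijk}$, $(i,j,k)\in\Omega$, be independent, $\mathcal Y_{ijk}$ having the Poisson distribution with parameter $\mathcal X^*_{ijk}$, and write $\mathcal Y_\Omega=(\mathcal Y_{ijk})_{(i,j,k)\in\Omega}$. Then $$\inf_{\widetilde{\mathcal X}}\ \sup_{\mathcal X^*\in\widetilde{\mathfrak U}(r,b,s,\zeta)}\frac{\mathbb E_{\Omega,\mathcal Y_\Omega}\|\widetilde{\mathcal X}-\mathcal X^*\|_F^2}{n_1n_2n_3}\ \ge\ \widetilde C\min\left\{\widetilde\Delta\, b^2,\ \widetilde\beta_c^2\,\zeta\left(\frac{s-n_2n_3+rn_1n_3}{m}\right)\right\},$$ where the infimum is over all estimators $\widetilde{\mathcal X}$, that is, all functions of $(\Omega,\mathcal Y_\Omega)$ with values in $\mathbb R^{n_1\times n_2\times n_3}$, and $$\widetilde\Delta=\min\left\{\Big(1-\frac{\zeta}{b}\Big)^2,\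 \Delta_1\right\},\qquad \Delta_1=\min\left\{1,\ \frac{s-n_2n_3}{n_2n_3}\right\}.$$ -/

import Mathlib

open scoped ENNReal

noncomputable section

namespace SparseNTF

/-- Real third-order tensors of size `n₁ × n₂ × n₃`; the third index numbers the frontal slices
(from `0`). -/
abbrev Tensor (n₁ n₂ n₃ : ℕ) : Type := Fin n₁ → Fin n₂ → Fin n₃ → ℝ

/-- The index set of the entries of an `n₁ × n₂ × n₃` tensor. -/
abbrev Idx (n₁ n₂ n₃ : ℕ) : Type := Fin n₁ × Fin n₂ × Fin n₃

/-- The frontal slices stacked on top of each other; `(k, i)` is the `i`th row of block `k`. -/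
def unfold {n₁ n₂ n₃ : ℕ} (X : Tensor n₁ n₂ n₃) : Matrix (Fin n₃ × Fin n₁) (Fin n₂) ℝ :=
  Matrix.of fun p j => X p.2 j p.1

/-- The inverse of `unfold`. -/
def fold {n₁ n₂ n₃ : ℕ} (M : Matrix (Fin n₃ × Fin n₁) (Fin n₂) ℝ) : Tensor n₁ n₂ n₃ :=
  fun i j k => M (k, i) j

/-- The block circulant matrix: block `(k, l)` is the frontal slice with index `k - l` modulo
`n₃` (subtraction in `Fin n₃` is cyclic). -/
def circ {n₁ n₂ n₃ : ℕ} (X : Tensor n₁ n₂ n₃) :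
    Matrix (Fin n₃ × Fin n₁) (Fin n₃ × Fin n₂) ℝ :=
  Matrix.of fun p q => X p.2 q.2 (p.1 - q.1)

/-- The tensor-tensor product `Fold (Circ (Unfold A) * Unfold B)`. -/
def tensorProd {n₁ r n₂ n₃ : ℕ} (A : Tensor n₁ r n₃) (B : Tensor r n₂ n₃) : Tensor n₁ n₂ n₃ :=
  fold (circ A * unfold B)

/-- The number of nonzero entries. -/
def l0norm {n₁ n₂ n₃ : ℕ} (X : Tensor n₁ n₂ n₃) : ℕ :=
  (Finset.univ.filter fun e : Idx n₁ n₂ n₃ => X e.1 e.2.1 e.2.2 ≠ 0).card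

/-- The squared Frobenius norm. -/
def frobSq {n₁ n₂ n₃ : ℕ} (X : Tensor n₁ n₂ n₃) : ℝ :=
  ∑ i, ∑ j, ∑ k, X i j k ^ 2

/-- The strictly positive candidate class: products `A ◇ B` with all entries at least `ζ`, where
`A` has entries in `[0, 1]` and `B` has entries in `[0, b]`, at most `s` of them nonzero. -/
def positiveClass (n₁ n₂ n₃ r : ℕ) (b : ℝ) (s : ℕ) (ζ : ℝ) : Set (Tensor n₁ n₂ n₃) :=
  {X | ∃ (A : Tensor n₁ r n₃) (B : Tensor r n₂ n₃), X = tensorProd A B ∧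
    (∀ i j k, 0 ≤ X i j k) ∧ (∀ i j k, ζ ≤ X i j k) ∧
    (∀ i j k, 0 ≤ A i j k ∧ A i j k ≤ 1) ∧
    (∀ i j k, 0 ≤ B i j k ∧ B i j k ≤ b) ∧
    l0norm B ≤ s}

/-- The probability of the set `Ω` when every index is selected independently with
probability `γ`. -/
def bernProb {n₁ n₂ n₃ : ℕ} (γ : ℝ) (Ω : Finset (Idx n₁ n₂ n₃)) : ℝ :=
  γ ^ Ω.card * (1 - γ) ^ Ωᶜ.card

/-- The law of the observations `Y_Ω`: independent Poisson counts, the one at the index `e ∈ Ω`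
having the parameter `X e`. -/
def poissonObs {n₁ n₂ n₃ : ℕ} (X : Tensor n₁ n₂ n₃) (Ω : Finset (Idx n₁ n₂ n₃)) :
    MeasureTheory.Measure (Ω → ℕ) :=
  MeasureTheory.Measure.pi fun e : Ω =>
    ProbabilityTheory.poissonMeasure (X e.1.1 e.1.2.1 e.1.2.2).toNNReal

/-- An estimator: any function of the observed data `(Ω, Y_Ω)`. The data space is countable and
discrete, so that every such function is measurable. -/
abbrev Estimator (n₁ n₂ n₃ : ℕ) : Type :=
  (Ω : Finset (Idx n₁ n₂ n₃)) → (Ω → ℕ) → Tensor n₁ n₂ n₃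

/-- The risk `𝔼_{Ω, Y_Ω} ‖T(Ω, Y_Ω) - X‖_F² / (n₁ n₂ n₃)`, possibly infinite, of the estimator `T`
at `X`, under Bernoulli(`γ`) sampling and Poisson observations. -/
def risk {n₁ n₂ n₃ : ℕ} (γ : ℝ) (T : Estimator n₁ n₂ n₃) (X : Tensor n₁ n₂ n₃) : ℝ≥0∞ :=
  (∑ Ω : Finset (Idx n₁ n₂ n₃), ENNReal.ofReal (bernProb γ Ω) *
      ∫⁻ y, ENNReal.ofReal (frobSq (T Ω y - X)) ∂(poissonObs X Ω)) /
    ((n₁ * n₂ * n₃ : ℕ) : ℝ≥0∞)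

/-- The minimax risk over the class `U`. -/
def minimaxRisk {n₁ n₂ n₃ : ℕ} (γ : ℝ) (U : Set (Tensor n₁ n₂ n₃)) : ℝ≥0∞ :=
  ⨅ T : Estimator n₁ n₂ n₃, ⨆ X ∈ U, risk γ T X

/-- `Δ₁ = min {1, (s - n₂ n₃) / (n₂ n₃)}`. -/
def delta1 (n₂ n₃ s : ℕ) : ℝ :=
  min 1 (((s : ℝ) - n₂ * n₃) / (n₂ * n₃))

/-- `Δ̃ = min {(1 - ζ / b)², Δ₁}`. -/
def deltaTilde (n₂ n₃ s : ℕ) (b ζ : ℝ) : ℝ :=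
  min ((1 - ζ / b) ^ 2) (delta1 n₂ n₃ s)

end SparseNTF

end

namespace SparseNTF

open MeasureTheory ProbabilityTheory

/-! Assouad's method on two hypercubes of tensors with entries `ζ` or `ζ + v`. Flipping one bit
changes at most `G` entries, each with squared Hellinger-type distance at most `v² / (4ζ)`; if `γ G
v² ≤ ζ`, the observed data cannot tell the two tensors apart, so every entry governed by a bit costs
a constant times `v²` on average (`le_minimaxRisk_of_bitTensor`). One hypercube puts its bits in `A`
and yields the term `r n₁ n₃ / m` (`le_minimaxRisk_left`); the other puts them in `B` and yields `(s
- n₂ n₃) / m` (`le_minimaxRisk_right`). In both, the inner index `0` produces the constant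
background `ζ`, and a balanced labelling by the remaining inner indices keeps `G` small. The larger
of the two bounds dominates their sum up to a constant. -/

/-! ### Two-point bound for products of Poisson laws -/

/-- Multiplied by `p + q`, the difference of the sides is a sum of two squares: one vanishes at the
optimal `t`, the other is the AM-GM defect of `p` and `q`. -/
theorem sq_error_two_point (t a b p q : ℝ) (hp : 0 ≤ p) (hq : 0 ≤ q) :
    (a - b) ^ 2 * √(p * q) ≤
      (t - a) ^ 2 * p + (t - b) ^ 2 * q + (a - b) ^ 2 / 4 * (p + q) := by
  obtain ⟨u, hu, rfl⟩ : ∃ u, 0 ≤ u ∧ p = u ^ 2 := ⟨√p, Real.sqrt_nonneg _, (Real.sq_sqrt hp).symm⟩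
  obtain ⟨w, hw, rfl⟩ : ∃ w, 0 ≤ w ∧ q = w ^ 2 := ⟨√q, Real.sqrt_nonneg _, (Real.sq_sqrt hq).symm⟩
  rw [← mul_pow, Real.sqrt_sq (mul_nonneg hu hw)]
  rcases (add_nonneg (sq_nonneg u) (sq_nonneg w)).eq_or_lt with h | h
  · have hu0 : u = 0 := by nlinarith [sq_nonneg u, sq_nonneg w]
    have hw0 : w = 0 := by nlinarith [sq_nonneg u, sq_nonneg w]
    simp [hu0, hw0]
  · have key : 0 ≤ ((t - a) * u ^ 2 + (t - b) * w ^ 2) ^ 2 +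
        ((a - b) * (u ^ 2 + w ^ 2 - 2 * u * w) / 2) ^ 2 := by positivity
    have h2 : ((t - a) * u ^ 2 + (t - b) * w ^ 2) ^ 2 +
        ((a - b) * (u ^ 2 + w ^ 2 - 2 * u * w) / 2) ^ 2 = (u ^ 2 + w ^ 2) *
        ((t - a) ^ 2 * u ^ 2 + (t - b) ^ 2 * w ^ 2 + (a - b) ^ 2 / 4 * (u ^ 2 + w ^ 2) -
          (a - b) ^ 2 * (u * w)) := by ring
    rw [h2] at key
    linarith [nonneg_of_mul_nonneg_right key h]

/-- The geometric mean of two Poisson laws is a multiple of a Poisson law. -/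
theorem sqrt_poisson_mul_poisson (x y : ℝ) (hx : 0 ≤ x) (hy : 0 ≤ y) (n : ℕ) :
    √((poissonMeasure x.toNNReal).real {n} * (poissonMeasure y.toNNReal).real {n}) =
      Real.exp (-(√x - √y) ^ 2 / 2) * (poissonMeasure (√(x * y)).toNNReal).real {n} := by
  obtain ⟨u, hu, rfl⟩ : ∃ u, 0 ≤ u ∧ x = u ^ 2 := ⟨√x, Real.sqrt_nonneg _, (Real.sq_sqrt hx).symm⟩
  obtain ⟨w, hw, rfl⟩ : ∃ w, 0 ≤ w ∧ y = w ^ 2 := ⟨√y, Real.sqrt_nonneg _, (Real.sq_sqrt hy).symm⟩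
  rw [← mul_pow, Real.sqrt_sq (mul_nonneg hu hw), Real.sqrt_sq hu, Real.sqrt_sq hw]
  simp only [poissonMeasure_real_singleton, Real.coe_toNNReal _ hx, Real.coe_toNNReal _ hy,
    Real.coe_toNNReal _ (mul_nonneg hu hw)]
  rw [Real.sqrt_eq_iff_mul_self_eq (by positivity) (by positivity)]
  have h1 : Real.exp (-(u - w) ^ 2 / 2) * Real.exp (-(u - w) ^ 2 / 2) *
      (Real.exp (-(u * w)) * Real.exp (-(u * w))) = Real.exp (-u ^ 2) * Real.exp (-w ^ 2) := by
    simp only [← Real.exp_add]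
    congr 1
    ring
  generalize Real.exp (-(u - w) ^ 2 / 2) = c at h1 ⊢
  linear_combination (-(u * w) ^ n * (u * w) ^ n / (n.factorial * n.factorial)) * h1

theorem poissonPi_real_singleton {ι : Type*} [Fintype ι] (x : ι → ℝ) (y : ι → ℕ) :
    (Measure.pi fun e => poissonMeasure (x e).toNNReal).real {y} =
      ∏ e, (poissonMeasure (x e).toNNReal).real {y e} := by
  simp [measureReal_def, Measure.pi_singleton, ENNReal.toReal_prod]

/-- The pointwise bound summed over atoms; the geometric mean of the two laws has total mass equal
to the product of exponentials. -/
theorem poissonPi_two_point {ι : Type*} [Fintype ι] (x y : ι → ℝ) (hx : ∀ e, 0 ≤ x e)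
    (hy : ∀ e, 0 ≤ y e) (f : (ι → ℕ) → ℝ) (a b : ℝ) :
    ENNReal.ofReal ((a - b) ^ 2 * ∏ e, Real.exp (-(√(x e) - √(y e)) ^ 2 / 2)) ≤
      ∫⁻ z, ENNReal.ofReal ((f z - a) ^ 2) ∂(Measure.pi fun e => poissonMeasure (x e).toNNReal) +
      ∫⁻ z, ENNReal.ofReal ((f z - b) ^ 2) ∂(Measure.pi fun e => poissonMeasure (y e).toNNReal) +
      ENNReal.ofReal ((a - b) ^ 2 / 2) := by
  set μ := Measure.pi fun e => poissonMeasure (x e).toNNReal with hμ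
  set ν := Measure.pi fun e => poissonMeasure (y e).toNNReal with hν
  set ρ := Measure.pi fun e => poissonMeasure (√(x e * y e)).toNNReal with hρ
  set c := ∏ e, Real.exp (-(√(x e) - √(y e)) ^ 2 / 2) with hc
  have hc0 : 0 ≤ c := Finset.prod_nonneg fun _ _ => (Real.exp_pos _).le
  have hsqrt (z : ι → ℕ) : √(μ.real {z} * ν.real {z}) = c * ρ.real {z} := by
    rw [hμ, hν, hρ, hc, poissonPi_real_singleton, poissonPi_real_singleton,
      poissonPi_real_singleton, ← Finset.prod_mul_distrib, ← Finset.prod_mul_distrib,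
      Real.sqrt_prod _ (fun _ _ => by positivity)]
    exact Finset.prod_congr rfl fun e _ => sqrt_poisson_mul_poisson _ _ (hx e) (hy e) _
  have h1 : ENNReal.ofReal ((a - b) ^ 2 * c) =
      ∫⁻ _, ENNReal.ofReal ((a - b) ^ 2 * c) ∂ρ := by simp
  have h2 : ENNReal.ofReal ((a - b) ^ 2 / 2) =
      ∫⁻ _, ENNReal.ofReal ((a - b) ^ 2 / 4) ∂μ + ∫⁻ _, ENNReal.ofReal ((a - b) ^ 2 / 4) ∂ν := by
    simp only [lintegral_const, measure_univ, mul_one]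
    rw [← ENNReal.ofReal_add (by positivity) (by positivity)]
    ring_nf
  rw [h1, h2]
  simp only [lintegral_countable']
  rw [← ENNReal.tsum_add, ← ENNReal.tsum_add, ← ENNReal.tsum_add]
  refine ENNReal.tsum_le_tsum fun z => ?_
  rw [← ofReal_measureReal (μ := μ), ← ofReal_measureReal (μ := ν), ← ofReal_measureReal (μ := ρ)]
  simp only [← ENNReal.ofReal_mul (sq_nonneg _), ← ENNReal.ofReal_mul (mul_nonneg (sq_nonneg _) hc0),
    ← ENNReal.ofReal_mul (show 0 ≤ (a - b) ^ 2 / 4 by positivity)]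
  rw [← ENNReal.ofReal_add (by positivity) (by positivity),
    ← ENNReal.ofReal_add (by positivity) (by positivity),
    ← ENNReal.ofReal_add (by positivity) (by positivity)]
  refine ENNReal.ofReal_le_ofReal ?_
  have := sq_error_two_point (f z) a b (μ.real {z}) (ν.real {z}) measureReal_nonneg
    measureReal_nonneg
  rw [hsqrt] at this
  linarith

theorem one_sub_sum_le_prod {ι : Type*} (s : Finset ι) (t : ι → ℝ) (h0 : ∀ e ∈ s, 0 ≤ t e)
    (h1 : ∀ e ∈ s, t e ≤ 1) : 1 - ∑ e ∈ s, t e ≤ ∏ e ∈ s, (1 - t e) := by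
  classical
  induction s using Finset.induction_on with
  | empty => simp
  | insert a s ha ih =>
    rw [Finset.sum_insert ha, Finset.prod_insert ha]
    have ih' := ih (fun e he => h0 e (by simp [he])) (fun e he => h1 e (by simp [he]))
    have hs : 0 ≤ ∑ e ∈ s, t e := Finset.sum_nonneg fun e he => h0 e (by simp [he])
    nlinarith [h0 a (by simp), h1 a (by simp)]

variable {n₁ n₂ n₃ : ℕ}

/-! ### Random sampling and the entrywise risk -/

theorem bernProb_nonneg {γ : ℝ} (h0 : 0 ≤ γ) (h1 : γ ≤ 1) (Ω : Finset (Idx n₁ n₂ n₃)) :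
    0 ≤ bernProb γ Ω :=
  mul_nonneg (pow_nonneg h0 _) (pow_nonneg (by linarith) _)

theorem sum_bernProb_mul_prod (γ : ℝ) (c : Idx n₁ n₂ n₃ → ℝ) :
    ∑ Ω, bernProb γ Ω * ∏ e ∈ Ω, c e = ∏ e, (1 - γ * (1 - c e)) := by
  have h : ∀ e, 1 - γ * (1 - c e) = γ * c e + (1 - γ) := fun e => by ring
  simp only [h, Fintype.prod_add, bernProb, Finset.prod_mul_distrib, Finset.prod_const]
  exact Finset.sum_congr rfl fun _ _ => by ring

theorem sum_bernProb (γ : ℝ) : ∑ Ω : Finset (Idx n₁ n₂ n₃), bernProb γ Ω = 1 := by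
  simpa using sum_bernProb_mul_prod (n₁ := n₁) (n₂ := n₂) (n₃ := n₃) γ (fun _ => 1)

/-- The mean squared error at the index `e`. -/
noncomputable def entryRisk (γ : ℝ) (T : Estimator n₁ n₂ n₃) (X : Tensor n₁ n₂ n₃) (e : Idx n₁ n₂ n₃) : ℝ≥0∞ :=
  ∑ Ω : Finset (Idx n₁ n₂ n₃), ENNReal.ofReal (bernProb γ Ω) *
    ∫⁻ y, ENNReal.ofReal ((T Ω y e.1 e.2.1 e.2.2 - X e.1 e.2.1 e.2.2) ^ 2) ∂(poissonObs X Ω)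

theorem risk_eq_sum_entryRisk (γ : ℝ) (T : Estimator n₁ n₂ n₃) (X : Tensor n₁ n₂ n₃) :
    risk γ T X = (∑ e, entryRisk γ T X e) / ((n₁ * n₂ * n₃ : ℕ) : ℝ≥0∞) := by
  unfold risk entryRisk
  congr 1
  rw [Finset.sum_comm]
  refine Finset.sum_congr rfl fun Ω _ => ?_
  rw [← Finset.mul_sum, ← lintegral_finsetSum' _ fun _ _ => AEMeasurable.of_discrete]
  congr 2
  funext y
  rw [← ENNReal.ofReal_sum_of_nonneg fun _ _ => sq_nonneg _, frobSq]
  simp only [Fintype.sum_prod_type, Pi.sub_apply]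

theorem entryRisk_two_point {γ : ℝ} (h0 : 0 ≤ γ) (h1 : γ ≤ 1) (T : Estimator n₁ n₂ n₃)
    (X Y : Tensor n₁ n₂ n₃) (hX : ∀ i j k, 0 ≤ X i j k) (hY : ∀ i j k, 0 ≤ Y i j k)
    (hXY : γ * ∑ e : Idx n₁ n₂ n₃,
      (√(X e.1 e.2.1 e.2.2) - √(Y e.1 e.2.1 e.2.2)) ^ 2 ≤ 1 / 4) (e : Idx n₁ n₂ n₃) :
    ENNReal.ofReal (3 / 8 * (X e.1 e.2.1 e.2.2 - Y e.1 e.2.1 e.2.2) ^ 2) ≤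
      entryRisk γ T X e + entryRisk γ T Y e := by
  set d := (X e.1 e.2.1 e.2.2 - Y e.1 e.2.1 e.2.2) ^ 2 with hd
  have hd0 : 0 ≤ d := sq_nonneg _
  let c : Idx n₁ n₂ n₃ → ℝ := fun e =>
    Real.exp (-(√(X e.1 e.2.1 e.2.2) - √(Y e.1 e.2.1 e.2.2)) ^ 2 / 2)
  have hc0 (e) : 0 ≤ c e := (Real.exp_pos _).le
  have hc1 (e) : c e ≤ 1 := Real.exp_le_one_iff.2 (by
    have := sq_nonneg (√(X e.1 e.2.1 e.2.2) - √(Y e.1 e.2.1 e.2.2)); linarith)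
  -- Averaged over `Ω`, the affinity factorises; by `1 - exp (-h / 2) ≤ h / 2` its defect is at most
  -- half of `1 / 4`.
  have hprod : 7 / 8 ≤ ∑ Ω, bernProb γ Ω * ∏ e ∈ Ω, c e := by
    rw [sum_bernProb_mul_prod]
    refine le_trans ?_ (one_sub_sum_le_prod _ _ (fun e _ => ?_) fun e _ => ?_)
    · have : ∑ e, γ * (1 - c e) ≤ γ * ∑ e : Idx n₁ n₂ n₃,
          (√(X e.1 e.2.1 e.2.2) - √(Y e.1 e.2.1 e.2.2)) ^ 2 / 2 := by
        rw [← Finset.mul_sum]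
        gcongr with e
        have := Real.add_one_le_exp (-(√(X e.1 e.2.1 e.2.2) - √(Y e.1 e.2.1 e.2.2)) ^ 2 / 2)
        simp only [c]
        linarith
      rw [← Finset.sum_div] at this
      linarith
    · exact mul_nonneg h0 (by linarith [hc1 e])
    · nlinarith [hc0 e, hc1 e]
  have hsum : ∑ Ω : Finset (Idx n₁ n₂ n₃), ENNReal.ofReal (bernProb γ Ω) *
      ENNReal.ofReal (d * ∏ e ∈ Ω, c e) ≤
      entryRisk γ T X e + entryRisk γ T Y e + ENNReal.ofReal (d / 2) := by
    have hhalf : ENNReal.ofReal (d / 2) = ∑ Ω : Finset (Idx n₁ n₂ n₃),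
        ENNReal.ofReal (bernProb γ Ω) * ENNReal.ofReal (d / 2) := by
      rw [← Finset.sum_mul, ← ENNReal.ofReal_sum_of_nonneg fun Ω _ => bernProb_nonneg h0 h1 Ω,
        sum_bernProb, ENNReal.ofReal_one, one_mul]
    rw [hhalf, entryRisk, entryRisk, ← Finset.sum_add_distrib, ← Finset.sum_add_distrib]
    refine Finset.sum_le_sum fun Ω _ => ?_
    rw [← mul_add, ← mul_add]
    gcongr
    rw [← Finset.prod_coe_sort]
    exact poissonPi_two_point (fun e : Ω => X e.1.1 e.1.2.1 e.1.2.2)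
      (fun e : Ω => Y e.1.1 e.1.2.1 e.1.2.2) (fun _ => hX _ _ _) (fun _ => hY _ _ _)
      (fun y => T Ω y e.1 e.2.1 e.2.2) _ _
  have hlow : ENNReal.ofReal (3 / 8 * d) + ENNReal.ofReal (d / 2) ≤
      ∑ Ω : Finset (Idx n₁ n₂ n₃), ENNReal.ofReal (bernProb γ Ω) *
        ENNReal.ofReal (d * ∏ e ∈ Ω, c e) := by
    simp only [← ENNReal.ofReal_mul (bernProb_nonneg h0 h1 _)]
    rw [← ENNReal.ofReal_add (by positivity) (by positivity), ← ENNReal.ofReal_sum_of_nonneg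
      fun Ω _ => mul_nonneg (bernProb_nonneg h0 h1 Ω)
        (mul_nonneg hd0 (Finset.prod_nonneg fun e _ => hc0 e))]
    refine ENNReal.ofReal_le_ofReal ?_
    have : ∑ Ω : Finset (Idx n₁ n₂ n₃), bernProb γ Ω * (d * ∏ e ∈ Ω, c e) =
        d * ∑ Ω, bernProb γ Ω * ∏ e ∈ Ω, c e := by
      rw [Finset.mul_sum]
      exact Finset.sum_congr rfl fun _ _ => by ring
    rw [this]
    nlinarith
  -- Cancels `d / 2`, using `7 / 8 = 3 / 8 + 1 / 2`.
  exact (ENNReal.add_le_add_iff_right ENNReal.ofReal_ne_top).1 (hlow.trans hsum)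

/-! ### Assouad's bound on hypercubes of tensors -/

/-- The tensor with entries `ζ + v` at those indices of `S` whose bit is set, and `ζ` elsewhere. -/
noncomputable def bitTensor {P : Type*} (ζ v : ℝ) (S : Finset (Idx n₁ n₂ n₃)) (ℓ : Idx n₁ n₂ n₃ → P)
    (ω : P → Bool) : Tensor n₁ n₂ n₃ :=
  fun i j k => ζ + if (i, j, k) ∈ S ∧ ω (ℓ (i, j, k)) = true then v else 0

theorem sq_sqrt_add_sub_sqrt_le {ζ v : ℝ} (hζ : 0 < ζ) (hv : 0 ≤ v) :
    (√(ζ + v) - √ζ) ^ 2 ≤ v ^ 2 / (4 * ζ) := by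
  have h1 := Real.sq_sqrt hζ.le
  have h2 := Real.sq_sqrt (add_nonneg hζ.le hv)
  have h3 : √ζ ≤ √(ζ + v) := Real.sqrt_le_sqrt (by linarith)
  have h4 := Real.sqrt_pos.2 hζ
  rw [le_div_iff₀ (by positivity)]
  have h5 : v = (√(ζ + v) - √ζ) * (√(ζ + v) + √ζ) := by nlinarith
  have h6 : (2 * √ζ) ^ 2 ≤ (√(ζ + v) + √ζ) ^ 2 := by gcongr; linarith
  calc (√(ζ + v) - √ζ) ^ 2 * (4 * ζ) = (√(ζ + v) - √ζ) ^ 2 * (2 * √ζ) ^ 2 := by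
        rw [mul_pow 2, h1]; ring
    _ ≤ (√(ζ + v) - √ζ) ^ 2 * (√(ζ + v) + √ζ) ^ 2 := by gcongr
    _ = v ^ 2 := by rw [← mul_pow, ← h5]

/-- Assouad's bound for a hypercube of tensors in which every bit controls at most `G` entries. -/
theorem le_minimaxRisk_of_bitTensor {P : Type*} [Fintype P] [DecidableEq P] {γ ζ v G : ℝ}
    (h0 : 0 ≤ γ) (h1 : γ ≤ 1) (hζ : 0 < ζ) (hv : 0 ≤ v) (S : Finset (Idx n₁ n₂ n₃))
    (ℓ : Idx n₁ n₂ n₃ → P) (hG : ∀ p, ((Finset.univ.filter fun e => ℓ e = p).card : ℝ) ≤ G)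
    (hGv : γ * G * v ^ 2 ≤ ζ) (U : Set (Tensor n₁ n₂ n₃))
    (hU : ∀ ω, bitTensor ζ v S ℓ ω ∈ U) :
    ENNReal.ofReal (3 / 16 * v ^ 2 * S.card / (n₁ * n₂ * n₃)) ≤ minimaxRisk γ U := by
  refine le_iInf fun T => ?_
  set M := ⨆ X ∈ U, risk γ T X with hM
  let flip : P → (P → Bool) → (P → Bool) := fun p ω => Function.update ω p (!ω p)
  have hflip (p) : Function.Involutive (flip p) := fun ω => by
    funext q; by_cases h : q = p <;> simp [flip, h]
  let X := bitTensor ζ v S ℓ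
  have hX (ω i j k) : 0 ≤ X ω i j k := by
    simp only [X, bitTensor]; split_ifs <;> linarith
  have hpair (ω : P → Bool) (e) (he : e ∈ S) : ENNReal.ofReal (3 / 8 * v ^ 2) ≤
      entryRisk γ T (X ω) e + entryRisk γ T (X (flip (ℓ e) ω)) e := by
    have hdiff : (X ω e.1 e.2.1 e.2.2 - X (flip (ℓ e) ω) e.1 e.2.1 e.2.2) ^ 2 = v ^ 2 := by
      cases h : ω (ℓ e) <;> simp [X, bitTensor, flip, he, h]
    rw [← hdiff]
    refine entryRisk_two_point h0 h1 T _ _ (hX _) (hX _) ?_ e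
    have hterm (f : Idx n₁ n₂ n₃) :
        (√(X ω f.1 f.2.1 f.2.2) - √(X (flip (ℓ e) ω) f.1 f.2.1 f.2.2)) ^ 2 ≤
          if ℓ f = ℓ e then v ^ 2 / (4 * ζ) else 0 := by
      have hv' : 0 ≤ v ^ 2 / (4 * ζ) := by positivity
      by_cases hf : ℓ f = ℓ e
      · rw [if_pos hf]
        by_cases hfS : f ∈ S
        · cases h : ω (ℓ e) <;> simp [X, bitTensor, flip, hfS, hf, h]
          · rw [← neg_sub, neg_sq]; exact sq_sqrt_add_sub_sqrt_le hζ hv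
          · exact sq_sqrt_add_sub_sqrt_le hζ hv
        · simpa [X, bitTensor, hfS] using hv'
      · simp [X, bitTensor, flip, hf]
    calc _ ≤ γ * ∑ f, if ℓ f = ℓ e then v ^ 2 / (4 * ζ) else 0 := by
          gcongr with f; exact hterm f
      _ = γ * ((Finset.univ.filter fun f => ℓ f = ℓ e).card * (v ^ 2 / (4 * ζ))) := by
          rw [← Finset.sum_filter, Finset.sum_const, nsmul_eq_mul]
      _ ≤ γ * (G * (v ^ 2 / (4 * ζ))) := by gcongr; exact hG _
      _ = (γ * G * v ^ 2) / (4 * ζ) := by ring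
      _ ≤ 1 / 4 := by rw [div_le_div_iff₀ (by positivity) (by norm_num)]; linarith
  have hentry (e) (he : e ∈ S) :
      (Fintype.card (P → Bool) : ℝ≥0∞) * ENNReal.ofReal (3 / 16 * v ^ 2) ≤ ∑ ω, entryRisk γ T (X ω) e := by
    -- Flipping a bit permutes the hypercube, so both halves of each pair have the same sum over
    -- `ω`.
    have h2 : ∑ ω, entryRisk γ T (X (flip (ℓ e) ω)) e = ∑ ω, entryRisk γ T (X ω) e :=
      Equiv.sum_comp (hflip (ℓ e)).toPerm fun ω => entryRisk γ T (X ω) e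
    have h3 := Finset.sum_le_sum fun ω (_ : ω ∈ Finset.univ) => hpair ω e he
    rw [Finset.sum_add_distrib, h2, ← two_mul, Finset.sum_const, nsmul_eq_mul,
      show (3 / 8 * v ^ 2 : ℝ) = 2 * (3 / 16 * v ^ 2) by ring,
      ENNReal.ofReal_mul (by norm_num), ENNReal.ofReal_ofNat, mul_left_comm] at h3
    exact (ENNReal.mul_le_mul_iff_right (by norm_num) (by norm_num)).1 h3
  have hrisk (ω) : (∑ e, entryRisk γ T (X ω) e) / ((n₁ * n₂ * n₃ : ℕ) : ℝ≥0∞) ≤ M := by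
    rw [← risk_eq_sum_entryRisk, hM]
    exact le_iSup₂ (f := fun X (_ : X ∈ U) => risk γ T X) (X ω) (hU ω)
  have hcard0 : (Fintype.card (P → Bool) : ℝ≥0∞) ≠ 0 := by simp
  have hcardT : (Fintype.card (P → Bool) : ℝ≥0∞) ≠ ∞ := ENNReal.natCast_ne_top _
  refine (ENNReal.mul_le_mul_iff_right hcard0 hcardT).1 ?_
  calc (Fintype.card (P → Bool) : ℝ≥0∞) *
        ENNReal.ofReal (3 / 16 * v ^ 2 * S.card / (n₁ * n₂ * n₃))
      ≤ (∑ _e ∈ S, (Fintype.card (P → Bool) : ℝ≥0∞) * ENNReal.ofReal (3 / 16 * v ^ 2)) /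
          ((n₁ * n₂ * n₃ : ℕ) : ℝ≥0∞) := by
        rw [Finset.sum_const, nsmul_eq_mul, mul_left_comm (S.card : ℝ≥0∞),
          mul_div_assoc (Fintype.card (P → Bool) : ℝ≥0∞)]
        gcongr
        rcases Nat.eq_zero_or_pos (n₁ * n₂ * n₃) with hN | hN
        · have hN' : (n₁ : ℝ) * n₂ * n₃ = 0 := by exact_mod_cast hN
          simp [hN']
        · rw [show (n₁ : ℝ) * n₂ * n₃ = ((n₁ * n₂ * n₃ : ℕ) : ℝ) by push_cast; rfl,
            ENNReal.ofReal_div_of_pos (by exact_mod_cast hN), ENNReal.ofReal_natCast,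
            mul_comm (3 / 16 * v ^ 2 : ℝ), ENNReal.ofReal_mul (by positivity),
            ENNReal.ofReal_natCast]
    _ ≤ (∑ e ∈ S, ∑ ω, entryRisk γ T (X ω) e) / ((n₁ * n₂ * n₃ : ℕ) : ℝ≥0∞) := by
        gcongr with e he; exact hentry e he
    _ ≤ (∑ e, ∑ ω, entryRisk γ T (X ω) e) / ((n₁ * n₂ * n₃ : ℕ) : ℝ≥0∞) := by
        gcongr; exact Finset.subset_univ _
    _ = ∑ ω, (∑ e, entryRisk γ T (X ω) e) / ((n₁ * n₂ * n₃ : ℕ) : ℝ≥0∞) := by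
        rw [Finset.sum_comm]; simp only [div_eq_mul_inv, Finset.sum_mul]
    _ ≤ ∑ _ω : P → Bool, M := Finset.sum_le_sum fun ω _ => hrisk ω
    _ = (Fintype.card (P → Bool) : ℝ≥0∞) * M := by rw [Finset.sum_const, nsmul_eq_mul]; rfl

/-- Takes the largest admissible `v`, namely `v² = min (b²) (ζ / (γ G))`. -/
theorem le_minimaxRisk_of_forall_bitTensor_mem {P : Type*} [Fintype P] [DecidableEq P]
    {γ ζ b G : ℝ} (h0 : 0 < γ) (h1 : γ ≤ 1) (hζ : 0 < ζ) (hb : 0 ≤ b) (hG0 : 0 < G)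
    (S : Finset (Idx n₁ n₂ n₃)) (ℓ : Idx n₁ n₂ n₃ → P)
    (hG : ∀ p, ((Finset.univ.filter fun e => ℓ e = p).card : ℝ) ≤ G)
    (U : Set (Tensor n₁ n₂ n₃))
    (hU : ∀ v, 0 ≤ v → v ≤ b → ∀ ω, bitTensor ζ v S ℓ ω ∈ U) :
    ENNReal.ofReal (3 / 16 * min (b ^ 2) (ζ / (γ * G)) * S.card / (n₁ * n₂ * n₃)) ≤
      minimaxRisk γ U := by
  have hm : 0 ≤ min (b ^ 2) (ζ / (γ * G)) := by positivity
  have hv2 : √(min (b ^ 2) (ζ / (γ * G))) ^ 2 = min (b ^ 2) (ζ / (γ * G)) := Real.sq_sqrt hm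
  rw [← hv2]
  refine le_minimaxRisk_of_bitTensor h0.le h1 hζ (Real.sqrt_nonneg _) S ℓ hG ?_ U
    (hU _ (Real.sqrt_nonneg _) ?_)
  · rw [hv2, mul_comm, ← le_div_iff₀ (by positivity)]
    exact min_le_right _ _
  · exact Real.sqrt_le_iff.2 ⟨hb, min_le_left _ _⟩

/-! ### Balanced labellings and hypercubes inside the class -/

/-- A labelling of `Fin n` by the labels `1, …, R` whose classes have comparable sizes. -/
theorem exists_balanced_labelling {n r R : ℕ} (hR : 1 ≤ R) (hRr : R < r) (hRn : R ≤ n) :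
    ∃ lab : Fin n → Fin r, (∀ i, 1 ≤ (lab i).val) ∧
      (∀ l, ((Finset.univ.filter fun i => lab i = l).card : ℝ) ≤ 2 * n / R) ∧
      ∀ l : Fin r, 1 ≤ l.val → l.val ≤ R →
        (n : ℝ) / (2 * R) ≤ (Finset.univ.filter fun i => lab i = l).card := by
  have hmod (i : ℕ) : i % R < R := Nat.mod_lt _ hR
  have hR' : (0 : ℝ) < R := by exact_mod_cast hR
  have hdiv : 1 ≤ n / R := (Nat.one_le_div_iff hR).2 hRn
  refine ⟨fun i => ⟨i.val % R + 1, by have := hmod i; omega⟩, fun i => by simp, fun l => ?_,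
    fun l h1 h2 => ?_⟩
  -- Indices with the same residue modulo `R` have distinct quotients, all at most `n / R`.
  · have hcard : (Finset.univ.filter fun i : Fin n =>
        (⟨i.val % R + 1, by have := hmod i; omega⟩ : Fin r) = l).card ≤ n / R + 1 := by
      rw [← Finset.card_range (n / R + 1)]
      refine Finset.card_le_card_of_injOn (fun i => i.val / R) (fun i _ => ?_) fun i hi j hj h => ?_
      · simpa using Nat.lt_succ_of_le (Nat.div_le_div_right i.2.le)
      · simp only [Finset.coe_filter, Finset.mem_univ, true_and, Set.mem_ofPred_eq] at hi hj
        have hm := hi.trans hj.symm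
        simp only [Fin.mk.injEq] at hm
        have e1 := Nat.div_add_mod i.val R
        have e2 := Nat.div_add_mod j.val R
        simp only at h
        rw [h] at e1
        exact Fin.ext (by omega)
    have h3 : R * (n / R + 1) ≤ 2 * n := by
      have := Nat.mul_div_le n R
      rw [Nat.mul_add]; omega
    rw [le_div_iff₀ hR']
    calc _ ≤ (((n / R + 1 : ℕ) : ℝ)) * R := by gcongr
      _ ≤ 2 * n := by rw [mul_comm]; exact_mod_cast h3
  · have hcard : n / R ≤ (Finset.univ.filter fun i : Fin n =>
        (⟨i.val % R + 1, by have := hmod i; omega⟩ : Fin r) = l).card := by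
      have hlt (t : Fin (n / R)) : t.val * R + (l.val - 1) < n := by
        have h4 := Nat.mul_div_le n R
        have h5 : (t.val + 1) * R ≤ R * (n / R) := by
          rw [mul_comm]; exact Nat.mul_le_mul_left _ t.2
        rw [add_mul] at h5; omega
      conv_lhs => rw [← Fintype.card_fin (n / R), ← Finset.card_univ]
      refine Finset.card_le_card_of_injOn (fun t => ⟨t.val * R + (l.val - 1), hlt t⟩)
        (fun t _ => ?_) fun t _ u _ h => ?_
      · have : (t.val * R + (l.val - 1)) % R = l.val - 1 := by
          rw [Nat.mul_add_mod', Nat.mod_eq_of_lt (by omega)]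
        simp only [Finset.coe_filter, Finset.mem_univ, true_and, Set.mem_ofPred_eq, Fin.ext_iff]
        omega
      · simp only [Fin.mk.injEq, Nat.add_right_cancel_iff] at h
        exact Fin.ext (Nat.eq_of_mul_eq_mul_right hR h)
    have h3 : n ≤ n / R * (2 * R) := by
      have h4 := Nat.div_add_mod n R
      have h5 := hmod n
      have h6 : R ≤ R * (n / R) := Nat.le_mul_of_pos_right _ hdiv
      rw [show n / R * (2 * R) = R * (n / R) + R * (n / R) by ring]
      omega
    rw [div_le_iff₀ (by positivity)]
    calc (n : ℝ) ≤ ((n / R : ℕ) : ℝ) * (2 * R) := by exact_mod_cast h3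
      _ ≤ _ := by gcongr

theorem tensorProd_apply {r : ℕ} (A : Tensor n₁ r n₃) (B : Tensor r n₂ n₃) (i : Fin n₁)
    (j : Fin n₂) (k : Fin n₃) :
    tensorProd A B i j k = ∑ q, ∑ l, A i l (k - q) * B l j q := by
  simp [tensorProd, fold, circ, unfold, Matrix.mul_apply, Fintype.sum_prod_type]

theorem mem_positiveClass_of_bitTensor {P : Type*} {r s : ℕ} {b ζ v : ℝ} (hζ : 0 < ζ) (hv : 0 ≤ v)
    {S : Finset (Idx n₁ n₂ n₃)} {ℓ : Idx n₁ n₂ n₃ → P} {ω : P → Bool}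
    {A : Tensor n₁ r n₃} {B : Tensor r n₂ n₃} (hAB : tensorProd A B = bitTensor ζ v S ℓ ω)
    (hA : ∀ i j k, 0 ≤ A i j k ∧ A i j k ≤ 1) (hB : ∀ i j k, 0 ≤ B i j k ∧ B i j k ≤ b)
    (hs : l0norm B ≤ s) : bitTensor ζ v S ℓ ω ∈ positiveClass n₁ n₂ n₃ r b s ζ := by
  have h (i j k) : ζ ≤ bitTensor ζ v S ℓ ω i j k := by
    unfold bitTensor; split_ifs <;> linarith
  exact ⟨A, B, hAB.symm, fun i j k => hζ.le.trans (h i j k), h, hA, hB, hs⟩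

/-- Bit tensors realised by a fixed sparse second factor and a variable first factor. -/
theorem bitTensor_mem_positiveClass_left {r s : ℕ} [NeZero r] [NeZero n₃] {b ζ v : ℝ} (hζ : 0 < ζ)
    (hζb : ζ ≤ b) (hv : 0 ≤ v) (hvb : v ≤ b) (hs : 2 * n₂ ≤ s) (lab : Fin n₂ → Fin r)
    (hlab : ∀ j, lab j ≠ 0) (ω : Fin n₁ × Fin r × Fin n₃ → Bool) :
    bitTensor ζ v Finset.univ (fun e : Idx n₁ n₂ n₃ => (e.1, lab e.2.1, e.2.2)) ω ∈
      positiveClass n₁ n₂ n₃ r b s ζ := by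
  have hb : 0 < b := hζ.trans_le hζb
  have hvb' : v / b ≤ 1 := (div_le_one hb).2 hvb
  -- With `B` supported in slice `0`, the product acts slice by slice. Inner index `0` gives `1 *
  -- ζ`, index `lab j` gives `(v / b) * b` or `0`; each column of `B` has at most two nonzero
  -- entries.
  refine mem_positiveClass_of_bitTensor hζ hv
    (A := fun i l k => if l = 0 then 1 else if ω (i, l, k) = true then v / b else 0)
    (B := fun l j q => if q = 0 then (if l = 0 then ζ else if l = lab j then b else 0) else 0)
    ?_ (fun i l k => ?_) (fun l j q => ?_) ?_
  · funext i j k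
    rw [tensorProd_apply, Finset.sum_eq_single 0 (fun q _ hq => by simp [hq]) (by simp)]
    rw [Finset.sum_eq_add 0 (lab j) (hlab j).symm (fun l _ hl => by simp [hl.1, hl.2]) (by simp)
      (by simp)]
    by_cases h : ω (i, lab j, k) = true <;> simp [bitTensor, hlab, h, hb.ne']
  · by_cases h : l = 0
    · simp [h]
    · simp only [h, if_false]; split_ifs
      · exact ⟨by positivity, hvb'⟩
      · simp
  · split_ifs <;> constructor <;> linarith
  · refine le_trans ?_ hs
    have hsub : (Finset.univ.filter fun e : Idx r n₂ n₃ => (if e.2.2 = 0 then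
        (if e.1 = 0 then ζ else if e.1 = lab e.2.1 then b else 0) else 0) ≠ 0) ⊆
        (Finset.univ.image fun j : Fin n₂ => ((0, j, 0) : Idx r n₂ n₃)) ∪
          Finset.univ.image fun j : Fin n₂ => ((lab j, j, 0) : Idx r n₂ n₃) := by
      rintro ⟨l, j, q⟩ h
      simp only [Finset.mem_filter, Finset.mem_univ, true_and] at h
      split_ifs at h with h1 h2 h3
      · simp [h1, h2]
      · simp [h1, h3]
      · exact absurd rfl h
      · exact absurd rfl h
    refine (Finset.card_le_card hsub).trans ((Finset.card_union_le _ _).trans ?_)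
    rw [two_mul]
    refine add_le_add ?_ ?_ <;> refine Finset.card_image_le.trans (by simp)

/-- Bit tensors realised by a fixed first factor and a variable second factor. -/
theorem bitTensor_mem_positiveClass_right {r s : ℕ} [NeZero r] [NeZero n₃] {b ζ v : ℝ}
    (hζ : 0 < ζ) (hζb : ζ ≤ b) (hv : 0 ≤ v) (hvb : v ≤ b) (lab : Fin n₁ → Fin r)
    (hlab : ∀ i, lab i ≠ 0) (W : Finset (Idx r n₂ n₃)) (hs : n₂ * n₃ + W.card ≤ s)
    (ω : Idx r n₂ n₃ → Bool) :
    bitTensor ζ v (Finset.univ.filter fun e : Idx n₁ n₂ n₃ => (lab e.1, e.2) ∈ W)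
      (fun e => (lab e.1, e.2)) ω ∈ positiveClass n₁ n₂ n₃ r b s ζ := by
  -- Now `A` lives in slice `0`, and its row `i` adds the rows `0` and `lab i` of `B`. The
  -- background fills row `0` of `B`, at a cost of `n₂ n₃` nonzero entries.
  refine mem_positiveClass_of_bitTensor hζ hv
    (A := fun i l k => if k = 0 then (if l = 0 then 1 else if l = lab i then 1 else 0) else 0)
    (B := fun l j q => if l = 0 then ζ else if (l, j, q) ∈ W ∧ ω (l, j, q) = true then v else 0)
    ?_ (fun i l k => ?_) (fun l j q => ?_) ?_
  · funext i j k
    rw [tensorProd_apply, Finset.sum_eq_single k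
      (fun q _ hq => by simp [sub_eq_zero, hq.symm]) (by simp)]
    rw [Finset.sum_eq_add 0 (lab i) (hlab i).symm (fun l _ hl => by simp [hl.1, hl.2]) (by simp)
      (by simp)]
    simp [bitTensor, hlab]
  · split_ifs <;> simp
  · split_ifs <;> constructor <;> linarith
  · refine le_trans ?_ hs
    have hsub : (Finset.univ.filter fun e : Idx r n₂ n₃ => (if e.1 = 0 then ζ else
        if (e.1, e.2.1, e.2.2) ∈ W ∧ ω (e.1, e.2.1, e.2.2) = true then v else 0) ≠ 0) ⊆
        (Finset.univ.image fun p : Fin n₂ × Fin n₃ => ((0, p) : Idx r n₂ n₃)) ∪ W := by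
      rintro ⟨l, j, q⟩ h
      simp only [Finset.mem_filter, Finset.mem_univ, true_and] at h
      split_ifs at h with h1 h2
      · simp [h1]
      · simp [h2.1]
      · exact absurd rfl h
    refine (Finset.card_le_card hsub).trans ((Finset.card_union_le _ _).trans ?_)
    refine Nat.add_le_add_right (Finset.card_image_le.trans (by simp)) _

/-! ### The two lower bounds -/

theorem card_filter_label_fst {α : Type*} {r : ℕ} [Fintype α] [DecidableEq α]
    (lab : Fin n₁ → Fin r) (p : Fin r × α) :
    (Finset.univ.filter fun e : Fin n₁ × α => (lab e.1, e.2) = p).card =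
      (Finset.univ.filter fun i => lab i = p.1).card := by
  refine Finset.card_nbij' (fun e => e.1) (fun i => (i, p.2)) ?_ ?_ ?_ ?_
  · rintro e he; simp only [Finset.coe_filter, Finset.mem_univ, true_and, Set.mem_ofPred_eq] at he ⊢
    rw [← he]
  · rintro i hi; simp only [Finset.coe_filter, Finset.mem_univ, true_and, Set.mem_ofPred_eq] at hi ⊢
    rw [hi]
  · rintro e he; simp only [Finset.coe_filter, Finset.mem_univ, true_and, Set.mem_ofPred_eq] at he
    rw [← he]
  · rintro i hi; rfl

theorem card_filter_label_snd {r : ℕ} (lab : Fin n₂ → Fin r) (p : Fin n₁ × Fin r × Fin n₃) :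
    (Finset.univ.filter fun e : Idx n₁ n₂ n₃ => (e.1, lab e.2.1, e.2.2) = p).card =
      (Finset.univ.filter fun j => lab j = p.2.1).card := by
  refine Finset.card_nbij' (fun e => e.2.1) (fun j => (p.1, j, p.2.2)) ?_ ?_ ?_ ?_
  · rintro e he; simp only [Finset.coe_filter, Finset.mem_univ, true_and, Set.mem_ofPred_eq] at he ⊢
    rw [← he]
  · rintro i hi; simp only [Finset.coe_filter, Finset.mem_univ, true_and, Set.mem_ofPred_eq] at hi ⊢
    rw [hi]
  · rintro e he; simp only [Finset.coe_filter, Finset.mem_univ, true_and, Set.mem_ofPred_eq] at he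
    rw [← he]
  · rintro i hi; rfl

theorem le_minimaxRisk_left {r s m : ℕ} {b ζ : ℝ} (hn₁ : 2 ≤ n₁) (hn₂ : 2 ≤ n₂) (hn₃ : 2 ≤ n₃)
    (hr : 2 ≤ r) (hrn : r ≤ n₂) (hs : n₂ * n₃ < s) (hm : 0 < m) (hmN : m ≤ n₁ * n₂ * n₃)
    (hζ : 0 < ζ) (hζb : ζ < b) :
    ENNReal.ofReal (3 / 64 * min (b ^ 2) (ζ * (r * n₁ * n₃ / m))) ≤
      minimaxRisk ((m : ℝ) / (n₁ * n₂ * n₃)) (positiveClass n₁ n₂ n₃ r b s ζ) := by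
  have : NeZero r := ⟨by omega⟩
  have : NeZero n₃ := ⟨by omega⟩
  -- Label `0` is reserved for the background; `R + 1 ≤ 2 * R` makes the loss a constant.
  obtain ⟨R, rfl⟩ : ∃ R, r = R + 1 := ⟨r - 1, by omega⟩
  obtain ⟨lab, h1, h2, -⟩ := exists_balanced_labelling (n := n₂) (r := R + 1) (R := R) (by omega)
    (by omega) (by omega)
  have hR : (1 : ℝ) ≤ R := by exact_mod_cast (by omega : 1 ≤ R)
  have hn₁' : (0 : ℝ) < n₁ := by positivity
  have hn₂' : (0 : ℝ) < n₂ := by positivity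
  have hn₃' : (0 : ℝ) < n₃ := by positivity
  have hm' : (0 : ℝ) < m := by positivity
  have hb : 0 < b := hζ.trans hζb
  have key := le_minimaxRisk_of_forall_bitTensor_mem (γ := (m : ℝ) / (n₁ * n₂ * n₃)) (ζ := ζ)
    (b := b) (G := 2 * n₂ / R) (by positivity)
    ((div_le_one (by positivity)).2 (by exact_mod_cast hmN)) hζ hb.le (by positivity)
    Finset.univ (fun e : Idx n₁ n₂ n₃ => (e.1, lab e.2.1, e.2.2))
    (fun p => by rw [card_filter_label_snd]; exact h2 _) (positiveClass n₁ n₂ n₃ (R + 1) b s ζ)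
    (fun v hv hvb ω => bitTensor_mem_positiveClass_left hζ hζb.le hv hvb (by nlinarith) lab
      (fun j h => by have := h1 j; simp [h] at this) ω)
  refine le_trans (ENNReal.ofReal_le_ofReal ?_) key
  have hcard : ((Finset.univ : Finset (Idx n₁ n₂ n₃)).card : ℝ) = n₁ * n₂ * n₃ := by
    simp [mul_assoc]
  rw [hcard, mul_div_cancel_right₀ _ (by positivity)]
  have hmin : min (b ^ 2) (ζ * (((R + 1 : ℕ) : ℝ) * n₁ * n₃ / m)) ≤
      4 * min (b ^ 2) (ζ / ((m : ℝ) / (n₁ * n₂ * n₃) * (2 * n₂ / R))) := by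
    rw [mul_min_of_nonneg _ _ (by norm_num : (0 : ℝ) ≤ 4)]
    refine min_le_min (by nlinarith [sq_nonneg b]) ?_
    have e : 4 * (ζ / ((m : ℝ) / (n₁ * n₂ * n₃) * (2 * n₂ / R))) =
        ζ * (2 * R * n₁ * n₃ / m) := by field_simp; ring
    rw [e]
    push_cast
    gcongr
    linarith
  linarith

theorem le_minimaxRisk_right {r s m : ℕ} {b ζ : ℝ} (hn₁ : 2 ≤ n₁) (hn₂ : 2 ≤ n₂) (hn₃ : 2 ≤ n₃)
    (hrn : r ≤ n₁) (hs : n₂ * n₃ < s) (hsr : s ≤ r * n₂ * n₃) (hm : 0 < m)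
    (hmN : m ≤ n₁ * n₂ * n₃) (hζ : 0 < ζ) (hζb : ζ < b) :
    ENNReal.ofReal (3 / 64 * min (delta1 n₂ n₃ s * b ^ 2) (ζ * (((s : ℝ) - n₂ * n₃) / m))) ≤
      minimaxRisk ((m : ℝ) / (n₁ * n₂ * n₃)) (positiveClass n₁ n₂ n₃ r b s ζ) := by
  obtain ⟨D, hD⟩ : ∃ D, s = n₂ * n₃ + D := ⟨s - n₂ * n₃, by omega⟩
  have hD0 : 1 ≤ D := by omega
  set q := n₂ * n₃ with hq
  have hq0 : 0 < q := by positivity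
  -- `R` is the ceiling of `D / q`, the least number of rows of `B` that can hold `D` bits. As `R q
  -- < D + q = s ≤ r q`, label `0` stays free.
  obtain ⟨R, hR⟩ : ∃ R, R = (D - 1) / q + 1 := ⟨_, rfl⟩
  have hR1 : 1 ≤ R := hR ▸ Nat.le_add_left _ _
  have hmod := Nat.div_add_mod (D - 1) q
  have hlt := Nat.mod_lt (D - 1) hq0
  have hRq : R * q = q * ((D - 1) / q) + q := by rw [hR]; ring
  have hDR : D ≤ R * q := by omega
  have hRD : R * q < D + q := by omega
  have hRr : R < r := by
    have : R * q < r * q := by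
      have : r * q = r * n₂ * n₃ := by rw [hq]; ring
      omega
    exact lt_of_mul_lt_mul_right this (Nat.zero_le _)
  have : NeZero r := ⟨by omega⟩
  have : NeZero n₃ := ⟨by omega⟩
  obtain ⟨lab, h1, h2, h3⟩ := exists_balanced_labelling (n := n₁) (r := r) (R := R) hR1 hRr
    (by omega)
  obtain ⟨W, hW, hWD⟩ : ∃ W ⊆ (Finset.univ.filter fun l : Fin r => 1 ≤ l.val ∧ l.val ≤ R) ×ˢ
      (Finset.univ : Finset (Fin n₂ × Fin n₃)), W.card = D := by
    refine Finset.exists_subset_card_eq ?_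
    rw [Finset.card_product, Finset.card_univ, Fintype.card_prod, Fintype.card_fin,
      Fintype.card_fin]
    refine hDR.trans (Nat.mul_le_mul_right _ ?_)
    conv_lhs => rw [← Fintype.card_fin R, ← Finset.card_univ]
    refine Finset.card_le_card_of_injOn (fun t => ⟨t.val + 1, by omega⟩) (fun t _ => ?_)
      fun t _ u _ h => ?_
    · have := t.2
      simp only [Finset.coe_filter, Finset.mem_univ, true_and, Set.mem_ofPred_eq]; omega
    · simp only [Fin.mk.injEq] at h; exact Fin.ext (by omega)
  have hR' : (0 : ℝ) < R := by positivity
  have hD' : (0 : ℝ) < D := by positivity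
  have hn₁' : (0 : ℝ) < n₁ := by positivity
  have hn₂' : (0 : ℝ) < n₂ := by positivity
  have hn₃' : (0 : ℝ) < n₃ := by positivity
  have hm' : (0 : ℝ) < m := by positivity
  have hb : 0 < b := hζ.trans hζb
  set S := Finset.univ.filter fun e : Idx n₁ n₂ n₃ => (lab e.1, e.2) ∈ W with hS
  have key := le_minimaxRisk_of_forall_bitTensor_mem (γ := (m : ℝ) / (n₁ * n₂ * n₃)) (ζ := ζ)
    (b := b) (G := 2 * n₁ / R) (by positivity)
    ((div_le_one (by positivity)).2 (by exact_mod_cast hmN)) hζ hb.le (by positivity)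
    S (fun e : Idx n₁ n₂ n₃ => (lab e.1, e.2))
    (fun p => by rw [card_filter_label_fst]; exact h2 _) (positiveClass n₁ n₂ n₃ r b s ζ)
    (fun v hv hvb ω => bitTensor_mem_positiveClass_right hζ hζb.le hv hvb lab
      (fun j h => by have := h1 j; simp [h] at this) W (by omega) ω)
  refine le_trans (ENNReal.ofReal_le_ofReal ?_) key
  have hScard : D * (n₁ / (2 * R)) ≤ (S.card : ℝ) := by
    rw [Finset.card_eq_sum_card_fiberwise (f := fun e : Idx n₁ n₂ n₃ => (lab e.1, e.2)) (t := W)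
      (fun e he => by simpa [hS] using he), ← hWD]
    push_cast
    rw [← nsmul_eq_mul]
    refine Finset.card_nsmul_le_sum _ _ _ fun p hp => ?_
    have hfib : (S.filter fun e : Idx n₁ n₂ n₃ => (lab e.1, e.2) = p) =
        Finset.univ.filter fun e : Idx n₁ n₂ n₃ => (lab e.1, e.2) = p := by
      ext e
      simp only [hS, Finset.mem_filter, Finset.mem_univ, true_and, and_iff_right_iff_imp]
      rintro rfl; exact hp
    rw [hfib, card_filter_label_fst]
    have hp' := hW hp
    simp only [Finset.mem_product, Finset.mem_filter, Finset.mem_univ, true_and, and_true] at hp'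
    exact h3 _ hp'.1 hp'.2
  have hfrac : (D : ℝ) / (2 * R * q) ≤ S.card / (n₁ * n₂ * n₃) := by
    rw [le_div_iff₀ (by positivity)]
    refine le_trans (le_of_eq ?_) hScard
    rw [hq]; push_cast; field_simp
  have hsD : (s : ℝ) - n₂ * n₃ = D := by rw [hD, hq]; push_cast; ring
  have hqc : (q : ℝ) = n₂ * n₃ := by rw [hq]; push_cast; rfl
  have hq' : (0 : ℝ) < q := by positivity
  have hmin : min (delta1 n₂ n₃ s * b ^ 2) (ζ * (((s : ℝ) - n₂ * n₃) / m)) ≤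
      4 * (min (b ^ 2) (ζ / ((m : ℝ) / (n₁ * n₂ * n₃) * (2 * n₁ / R))) * (D / (2 * R * q))) := by
    rw [min_mul_of_nonneg _ _ (by positivity), mul_min_of_nonneg _ _ (by norm_num : (0 : ℝ) ≤ 4),
      hsD]
    refine min_le_min ?_ (le_of_eq ?_)
    · have hδ : delta1 n₂ n₃ s ≤ 4 * (D / (2 * R * q)) := by
        rw [delta1, hsD, ← hqc]
        have hRD' : (R : ℝ) * q ≤ D + q := by exact_mod_cast hRD.le
        have e : 4 * ((D : ℝ) / (2 * R * q)) = 2 * D / (R * q) := by field_simp; ring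
        rw [e]
        -- `R q ≤ D + q ≤ 2 max D q`, so `2 D / (R q)` is at least `min 1 (D / q)`.
        rcases le_total (q : ℝ) D with h | h
        · refine (min_le_left _ _).trans ?_
          rw [le_div_iff₀ (by positivity)]; linarith
        · refine (min_le_right _ _).trans ?_
          rw [div_le_div_iff₀ (by positivity) (by positivity)]
          nlinarith
      nlinarith [sq_nonneg b]
    · rw [hqc]; field_simp; ring
  have hmul := mul_le_mul_of_nonneg_left hfrac
    (show 0 ≤ min (b ^ 2) (ζ / ((m : ℝ) / (n₁ * n₂ * n₃) * (2 * n₁ / R))) by positivity)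
  rw [mul_div_assoc]
  linarith

end SparseNTF

theorem proposition6 :
    ∃ β C : ℝ, 0 < β ∧ β < 1 ∧ 0 < C ∧
      ∀ (n₁ n₂ n₃ r s m : ℕ) (b ζ : ℝ),
        2 ≤ n₁ → 2 ≤ n₂ → 2 ≤ n₃ →
        r ≤ min n₁ n₂ →
        n₂ * n₃ < s → s ≤ r * n₂ * n₃ →
        0 < m → m ≤ n₁ * n₂ * n₃ →
        0 < ζ → ζ < b →
        ENNReal.ofReal
            (C * min (SparseNTF.deltaTilde n₂ n₃ s b ζ * b ^ 2)
              (β ^ 2 * ζ * (((s : ℝ) - n₂ * n₃ + r * n₁ * n₃) / m))) ≤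
          SparseNTF.minimaxRisk ((m : ℝ) / (n₁ * n₂ * n₃))
            (SparseNTF.positiveClass n₁ n₂ n₃ r b s ζ) := by
  -- `β² = 1 / 4` turns the target into `(x + y) / 4`, which is below `max x y`.
  refine ⟨1 / 2, 3 / 64, by norm_num, by norm_num, by norm_num, ?_⟩
  intro n₁ n₂ n₃ r s m b ζ hn₁ hn₂ hn₃ hr hs hsr hm hmN hζ hζb
  have hr2 : 2 ≤ r := by
    by_contra h
    have h4 : r * (n₂ * n₃) ≤ 1 * (n₂ * n₃) := Nat.mul_le_mul_right _ (by omega)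
    rw [← mul_assoc] at h4
    omega
  have hL := SparseNTF.le_minimaxRisk_left hn₁ hn₂ hn₃ hr2 (hr.trans (min_le_right _ _)) hs hm hmN
    hζ hζb
  have hR := SparseNTF.le_minimaxRisk_right hn₁ hn₂ hn₃ (hr.trans (min_le_left _ _)) hs hsr hm hmN
    hζ hζb
  have hm' : (0 : ℝ) < m := by positivity
  set x : ℝ := ζ * (((s : ℝ) - n₂ * n₃) / m) with hx
  set y : ℝ := ζ * (r * n₁ * n₃ / m) with hy
  -- Since the class bounds the factors and not the product from above, `v` may reach `b`, and
  -- `deltaTilde ≤ delta1 ≤ 1` suffices.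
  have hδ : SparseNTF.deltaTilde n₂ n₃ s b ζ ≤ SparseNTF.delta1 n₂ n₃ s := min_le_right _ _
  have hδ1 : SparseNTF.delta1 n₂ n₃ s ≤ 1 := min_le_left _ _
  have hxy : (1 / 2 : ℝ) ^ 2 * ζ * (((s : ℝ) - n₂ * n₃ + r * n₁ * n₃) / m) = (x + y) / 4 := by
    rw [hx, hy]; ring
  have hx0 : 0 ≤ x := by
    have : (n₂ : ℝ) * n₃ ≤ s := by exact_mod_cast hs.le
    exact mul_nonneg hζ.le (div_nonneg (by linarith) hm'.le)
  have hy0 : 0 ≤ y := by positivity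
  rw [hxy]
  rcases le_total x y with h | h
  · refine le_trans (ENNReal.ofReal_le_ofReal ?_) hL
    gcongr
    · nlinarith [sq_nonneg b]
    · linarith
  · refine le_trans (ENNReal.ofReal_le_ofReal ?_) hR
    gcongr
    linarith
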